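/- Consider four point vortices in the plane $\mathbb{R}^2$ with vortex strengths $\Gamma_1=\Gamma_2=1$ and $\Gamma_3=\Gamma_4=m$, moving according to $$\Gamma_i\dot x_i=-J\sum_{j\neq i}\frac{\Gamma_i\Gamma_j}{\|x_i-x_j\|^2}(x_i-x_j),\qquad J=\begin{pmatrix}0&1\\-1&0\end{pmatrix},\qquad 1\le i\le 4 .$$ A relative equilibrium is a configuration $x=(x_1,\dots,x_4)$ of four distinct points for which there are $c\in\mathbb{R}^2$ and $\lambda\neq 0$ such that $x_i(t)=c+e^{-J\lambda t}(x_i-c)$ solves these equations; it is collinear if the four points lie on a line. Relative equilibria are counted up to rotation, scaling by a positive factor and translation of the plane (the vortices keep their labels and reflections are not allowed). A collinear configuration is called symmetric if its set of four positions is invariant under the reflection in some point, and asymmetric otherwise. An ordering of the vortices is the order of their labels along the line, an order and its reverse being identified, so that there are $4!/2=12$ orderings. 1. If $m\in(0,1]$, there are exactly 12 collinear relative equilibria, exactly one for each ordering of the vortices. - If $m=1$, all of them are symmetric, and any two of them become equivalent (under rotation, scaling and translation) after a relabelling of the vortices. - If $m\in(0,1)$, exactly 4 of them are symmetric and exactly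 8 are asymmetric. 2. If $m\in(-1/2,0)$, there are exactly 6 collinear relative equilibria: 2 symmetric and 4 asymmetric. 3. If $m\in(-1,-1/2]$, there are exactly 2 collinear relative equilibria; both are symmetric and there are no asymmetric ones. -/

import Mathlib

/-- A configuration of `n` planar point vortices; the plane `ℝ²` is identified with `ℂ`. -/
abbrev VortexConfig (n : ℕ) : Type := Fin n → ℂ

/-- The velocity `∑_{j ≠ i} (-J) (Γ j / r_{ij}²) (x i - x j)` of the `i`-th vortex, where
`J = [[0, 1], [-1, 0]]`, so that `-J` is multiplication by the imaginary unit on `ℂ = ℝ²`. -/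
noncomputable def vortexVelocity {n : ℕ} (Γ : Fin n → ℝ) (x : VortexConfig n) (i : Fin n) : ℂ :=
  Complex.I * ∑ j ∈ Finset.univ.erase i, (Γ j / ‖x i - x j‖ ^ 2 : ℝ) • (x i - x j)

/-- The configuration `c + e^{-Jωt} (x - c)`: `x` turned about `c` by the angle `ωt`. -/
noncomputable def rigidRotation {n : ℕ} (c : ℂ) (ω : ℝ) (x : VortexConfig n) (t : ℝ) :
    VortexConfig n :=
  fun i => c + Complex.exp (Complex.I * ((ω * t : ℝ) : ℂ)) * (x i - c)

/-- `x` is a relative equilibrium for the vortex strengths `Γ`: the vortices occupy distinct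
points, and some uniform rotation of `x` with nonzero angular velocity solves the equations of
motion of the point vortices. -/
def IsRelativeEquilibrium {n : ℕ} (Γ : Fin n → ℝ) (x : VortexConfig n) : Prop :=
  Function.Injective x ∧ ∃ (c : ℂ) (ω : ℝ), ω ≠ 0 ∧
    ∀ (t : ℝ) (i : Fin n), HasDerivAt (fun s : ℝ => rigidRotation c ω x s i)
      (vortexVelocity Γ (rigidRotation c ω x t) i) t

/-- The algebraic form of the definition: the equations of a central configuration. -/
theorem isRelativeEquilibrium_iff {n : ℕ} (Γ : Fin n → ℝ) (x : VortexConfig n) :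
    IsRelativeEquilibrium Γ x ↔ Function.Injective x ∧ ∃ (c : ℂ) (ω : ℝ), ω ≠ 0 ∧
      ∀ i : Fin n, -(ω • (x i - c)) =
        ∑ j ∈ Finset.univ.erase i, (Γ j / ‖x i - x j‖ ^ 2 : ℝ) • (x j - x i) := by
  have hd : ∀ (c : ℂ) (ω t : ℝ) (i : Fin n), HasDerivAt (fun s : ℝ => rigidRotation c ω x s i)
      (Complex.exp (Complex.I * ((ω * t : ℝ) : ℂ)) * (Complex.I * ω) * (x i - c)) t := by
    intro c ω t i
    have h1 : HasDerivAt (fun s : ℝ => Complex.I * ((ω * s : ℝ) : ℂ)) (Complex.I * ω) t := by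
      have h0 : HasDerivAt (fun s : ℝ => ω * s) ω t := by
        simpa using (hasDerivAt_id t).const_mul ω
      exact h0.ofReal_comp.const_mul Complex.I
    exact (h1.cexp.mul_const (x i - c)).const_add c
  have hv : ∀ (c : ℂ) (ω t : ℝ) (i : Fin n), vortexVelocity Γ (rigidRotation c ω x t) i =
      Complex.exp (Complex.I * ((ω * t : ℝ) : ℂ)) * Complex.I *
        -∑ j ∈ Finset.univ.erase i, (Γ j / ‖x i - x j‖ ^ 2 : ℝ) • (x j - x i) := by
    intro c ω t i
    have hn : ‖Complex.exp (Complex.I * ((ω * t : ℝ) : ℂ))‖ = 1 := by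
      rw [mul_comm]; exact Complex.norm_exp_ofReal_mul_I _
    have hs : ∀ j : Fin n, rigidRotation c ω x t i - rigidRotation c ω x t j =
        Complex.exp (Complex.I * ((ω * t : ℝ) : ℂ)) * (x i - x j) := by
      intro j; simp only [rigidRotation]; ring
    simp only [vortexVelocity, hs, norm_mul, hn, one_mul, ← Finset.sum_neg_distrib,
      Finset.mul_sum, Complex.real_smul]
    exact Finset.sum_congr rfl fun j _ => by ring
  refine and_congr_right fun _ => exists_congr fun c => exists_congr fun ω =>
    and_congr_right fun _ => ⟨fun h i => ?_, fun h t i => ?_⟩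
  · have h2 := (hd c ω 0 i).unique (h 0 i)
    rw [hv] at h2
    have h3 : Complex.I * (ω * (x i - c)) = Complex.I *
        -∑ j ∈ Finset.univ.erase i, (Γ j / ‖x i - x j‖ ^ 2 : ℝ) • (x j - x i) := by
      simpa [mul_assoc] using h2
    have h4 := mul_left_cancel₀ Complex.I_ne_zero h3
    rw [Complex.real_smul, h4, neg_neg]
  · have h2 := hd c ω t i
    rw [hv, ← h i, neg_neg, Complex.real_smul]
    convert h2 using 1
    ring

/-- Two configurations are equivalent if a rotation, a (positive) scaling and a translation carry
one to the other, vortex by vortex: the maps `z ↦ a z + b` with `a ≠ 0` are exactly the compositions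
of these. Reflections and relabellings are not allowed. -/
def configSetoid (n : ℕ) : Setoid (VortexConfig n) where
  r x y := ∃ a b : ℂ, a ≠ 0 ∧ ∀ i, y i = a * x i + b
  iseqv :=
    { refl := fun x => ⟨1, 0, one_ne_zero, fun i => by simp⟩
      symm := by
        rintro x y ⟨a, b, ha, h⟩
        refine ⟨a⁻¹, -(a⁻¹ * b), inv_ne_zero ha, fun i => ?_⟩
        rw [h i]
        field_simp
        ring
      trans := by
        rintro x y z ⟨a, b, ha, h⟩ ⟨a', b', ha', h'⟩
        refine ⟨a' * a, a' * b + b', mul_ne_zero ha' ha, fun i => ?_⟩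
        rw [h' i, h i]
        ring }

/-- The equivalence classes of the configurations in `S`. -/
def configClasses {n : ℕ} (S : Set (VortexConfig n)) : Set (Quotient (configSetoid n)) :=
  Quotient.mk (configSetoid n) '' S

/-- The vortices lie on a line, and `σ 0, σ 1, …, σ (n - 1)` is the order in which they appear when
the line is traversed in one of its two directions. -/
def HasOrdering {n : ℕ} (σ : Equiv.Perm (Fin n)) (x : VortexConfig n) : Prop :=
  ∃ (p v : ℂ) (t : Fin n → ℝ), v ≠ 0 ∧ StrictMono t ∧ ∀ k, x (σ k) = p + t k • v

/-- Symmetry of a collinear configuration: the set of positions is invariant under the reflection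
in some point `p` (equivalently, as the positions lie on a line, under the reflection in the
perpendicular to that line at `p`). -/
def IsSymmetricConfig {n : ℕ} (x : VortexConfig n) : Prop :=
  ∃ p : ℂ, ∀ i, ∃ j, x j = 2 * p - x i

/-- The vortex strengths `Γ₁ = Γ₂ = 1`, `Γ₃ = Γ₄ = m`. -/
def pairStrengths (m : ℝ) : Fin 4 → ℝ := ![1, 1, m, m]

/-- The collinear relative equilibria for the strengths `1, 1, m, m`. -/
def collinearRelEq (m : ℝ) : Set (VortexConfig 4) :=
  {x | IsRelativeEquilibrium (pairStrengths m) x ∧ Collinear ℝ (Set.range x)}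

/-- Those which are symmetric. -/
def symmetricCollinearRelEq (m : ℝ) : Set (VortexConfig 4) :=
  {x | x ∈ collinearRelEq m ∧ IsSymmetricConfig x}

/-- Those which are not symmetric. -/
def asymmetricCollinearRelEq (m : ℝ) : Set (VortexConfig 4) :=
  {x | x ∈ collinearRelEq m ∧ ¬ IsSymmetricConfig x}

/-! Each pair of equal strengths has a midpoint. Placing the two midpoints at 0 and h, with
half-distances s and r, turns the equations into polynomial ones. The maps z ↦ a z + b multiply (h,
s, r) by a, so each class has exactly one representative with h = 0, r = 1 or with h = 1
(`encard_configClasses`), and counting classes becomes counting real solutions.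

For h = 0 the system is a quadratic in s², with two positive roots if m > 0 and one if -1 < m < 0.
For h = 1, put M = 1 + m. Two equations are linear in s², r² and 1/ω, so s² and r² are affine in a
parameter z; a third becomes (25M² + 8M - 8) z² = 1. Positivity of s² and r² is governed by two
identities whose signs are those of 2M - 1 and M - 1, whence the thresholds m = -1/2 and m = 0: both
signs of z survive for m > 0, one for -1/2 < m < 0, none for -1 < m ≤ -1/2. Each surviving z gives
four choices of signs for (s, r). Configurations with h = 0 are symmetric; for h = 1 symmetry means
s² = r², and s² - r² = (m - 1) z with z ≠ 0, so it occurs only for m = 1.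

For positive strengths the equations are monotone on each ordering, so an ordering carries at most
one class (`equiv_of_hasOrdering`). Each of the 12 classes uses two mutually reverse permutations;
together they exhaust all 24, so existence for each ordering follows by counting. -/

/-! ### Collinear configurations on the real line -/

/-- The equations of a relative equilibrium on the real line. -/
theorem isRelativeEquilibrium_ofReal_iff {n : ℕ} (Γ t : Fin n → ℝ) :
    IsRelativeEquilibrium Γ (fun i => (t i : ℂ)) ↔ Function.Injective t ∧
      ∃ c ω : ℝ, ω ≠ 0 ∧ ∀ i, ω * (t i - c) = ∑ j, Γ j / (t i - t j) := by
  have key : ∀ i, ∑ j ∈ Finset.univ.erase i,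
      (Γ j / ‖(t i : ℂ) - t j‖ ^ 2 : ℝ) • ((t j : ℂ) - t i) =
      ((-∑ j, Γ j / (t i - t j) : ℝ) : ℂ) := by
    intro i
    -- The sum may run over all j, since the diagonal term is Γ i / 0 = 0.
    rw [← Finset.sum_erase (a := i) Finset.univ (by simp), ← Finset.sum_neg_distrib,
      Complex.ofReal_sum]
    refine Finset.sum_congr rfl fun j _ => ?_
    rw [← Complex.ofReal_sub, ← Complex.ofReal_sub, Complex.norm_real, Real.norm_eq_abs, sq_abs,
      Complex.real_smul, ← Complex.ofReal_mul]
    congr 1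
    rcases eq_or_ne (t i - t j) 0 with h | h
    · simp [h]
    · field_simp
      ring
  rw [isRelativeEquilibrium_iff]
  refine and_congr ⟨fun h i j hij => h (by simp [hij]), fun h i j hij => h (by simpa using hij)⟩ ?_
  simp only [key]
  constructor
  · rintro ⟨c, ω, hω, h⟩
    refine ⟨c.re, ω, hω, fun i => ?_⟩
    have := congrArg Complex.re (h i)
    simp only [Complex.real_smul, Complex.neg_re, Complex.re_ofReal_mul, Complex.sub_re,
      Complex.ofReal_re] at this
    linarith
  · rintro ⟨c, ω, hω, h⟩
    refine ⟨c, ω, hω, fun i => ?_⟩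
    rw [← h i, Complex.real_smul]
    push_cast
    ring

theorem IsRelativeEquilibrium.of_equiv {n : ℕ} {Γ : Fin n → ℝ} {x y : VortexConfig n}
    (hxy : (configSetoid n).r x y) (hx : IsRelativeEquilibrium Γ x) :
    IsRelativeEquilibrium Γ y := by
  obtain ⟨a, b, ha, h⟩ := hxy
  rw [isRelativeEquilibrium_iff] at hx ⊢
  obtain ⟨hinj, c, ω, hω, hc⟩ := hx
  have hn : ‖a‖ ≠ 0 := norm_ne_zero_iff.2 ha
  refine ⟨fun i j hij => hinj ?_, a * c + b, ω / ‖a‖ ^ 2, by positivity, fun i => ?_⟩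
  · simpa [h, ha] using hij
  · have := congrArg (fun z => ((‖a‖ ^ 2)⁻¹ : ℝ) • (a * z)) (hc i)
    simp only [Finset.mul_sum, Finset.smul_sum] at this
    refine Eq.trans ?_ (this.trans (Finset.sum_congr rfl fun j _ => ?_))
    · simp only [h, Complex.real_smul]
      push_cast
      ring
    · rw [h, h, show a * x i + b - (a * x j + b) = a * (x i - x j) by ring, norm_mul]
      simp only [Complex.real_smul]
      push_cast
      rw [mul_pow, div_eq_mul_inv, div_eq_mul_inv, mul_inv]
      ring

theorem IsSymmetricConfig.of_equiv {n : ℕ} {x y : VortexConfig n}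
    (hxy : (configSetoid n).r x y) (hx : IsSymmetricConfig x) : IsSymmetricConfig y := by
  obtain ⟨a, b, ha, h⟩ := hxy
  obtain ⟨p, hp⟩ := hx
  refine ⟨a * p + b, fun i => ?_⟩
  obtain ⟨j, hj⟩ := hp i
  exact ⟨j, by rw [h, h, hj]; ring⟩

theorem HasOrdering.reverse {n : ℕ} {σ : Equiv.Perm (Fin n)} {x : VortexConfig n}
    (hx : HasOrdering σ x) : HasOrdering (Fin.revPerm.trans σ) x := by
  obtain ⟨p, v, t, hv, ht, hp⟩ := hx
  refine ⟨p, -v, fun k => -t k.rev, neg_ne_zero.2 hv,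
    fun i j hij => neg_lt_neg (ht (Fin.rev_lt_rev.2 hij)), fun k => ?_⟩
  simp [hp]

/-- An injective collinear configuration is equivalent to one on the real line. -/
theorem exists_real_equiv_of_collinear {n : ℕ} {x : VortexConfig n} (hx : Function.Injective x)
    (hc : Collinear ℝ (Set.range x)) :
    ∃ (p v : ℂ) (t : Fin n → ℝ), v ≠ 0 ∧ Function.Injective t ∧ ∀ i, x i = p + t i • v := by
  obtain ⟨p, v, h⟩ := (collinear_iff_exists_forall_eq_smul_vadd _).1 hc
  choose t ht using fun i => h (x i) ⟨i, rfl⟩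
  -- If v = 0, all points coincide, so injectivity leaves at most one vortex and any direction
  -- serves.
  rcases eq_or_ne v 0 with rfl | hv
  · have hs : ∀ i j : Fin n, i = j := fun i j => hx (by rw [ht i, ht j]; simp)
    refine ⟨p, 1, fun _ => 0, one_ne_zero, fun i j _ => hs i j, fun i => by rw [ht i]; simp⟩
  · refine ⟨p, v, t, hv, fun i j hij => hx (by rw [ht i, ht j, hij]), fun i => ?_⟩
    rw [ht i, vadd_eq_add, add_comm]

theorem collinear_of_real_equiv {n : ℕ} {x : VortexConfig n} {p v : ℂ} {t : Fin n → ℝ}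
    (h : ∀ i, x i = p + t i • v) : Collinear ℝ (Set.range x) := by
  refine (collinear_iff_exists_forall_eq_smul_vadd _).2 ⟨p, v, ?_⟩
  rintro _ ⟨i, rfl⟩
  exact ⟨t i, by rw [h i, vadd_eq_add, add_comm]⟩

theorem configSetoid_ofReal {n : ℕ} {x : VortexConfig n} {p v : ℂ} {t : Fin n → ℝ} (hv : v ≠ 0)
    (h : ∀ i, x i = p + t i • v) : (configSetoid n).r (fun i => (t i : ℂ)) x :=
  ⟨v, p, hv, fun i => by rw [h i, Complex.real_smul]; ring⟩

theorem exists_hasOrdering {n : ℕ} {x : VortexConfig n} (hx : Function.Injective x)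
    (hc : Collinear ℝ (Set.range x)) : ∃ σ, HasOrdering σ x := by
  obtain ⟨p, v, t, hv, ht, h⟩ := exists_real_equiv_of_collinear hx hc
  refine ⟨Tuple.sort t, p, v, t ∘ Tuple.sort t, hv, ?_, fun k => h _⟩
  exact (Tuple.monotone_sort t).strictMono_of_injective (ht.comp (Tuple.sort t).injective)

theorem collinearRelEq_of_equiv {m : ℝ} {x y : VortexConfig 4}
    (hxy : (configSetoid 4).r x y) (hx : x ∈ collinearRelEq m) : y ∈ collinearRelEq m := by
  refine ⟨hx.1.of_equiv hxy, ?_⟩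
  obtain ⟨p, v, t, hv, ht, h⟩ := exists_real_equiv_of_collinear hx.1.1 hx.2
  obtain ⟨a, b, ha, hab⟩ := hxy
  refine collinear_of_real_equiv (p := a * p + b) (v := a * v) (t := t) fun i => ?_
  rw [hab, h, Complex.real_smul, Complex.real_smul]
  ring

/-! ### Uniqueness for a given ordering -/

/-- Antisymmetry of 1 / (t i - t j): swapping i and j and averaging turns u i into u i - u j. This
is the weak form of the equations, tested against u. -/
theorem sum_mul_sum_div_sub {n : ℕ} (Γ t u : Fin n → ℝ) :
    2 * ∑ i, Γ i * u i * ∑ j, Γ j / (t i - t j) =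
      ∑ i, ∑ j, Γ i * Γ j * ((u i - u j) / (t i - t j)) := by
  have h1 : ∑ i, Γ i * u i * ∑ j, Γ j / (t i - t j) =
      ∑ i, ∑ j, Γ i * Γ j * (u i / (t i - t j)) := by
    refine Finset.sum_congr rfl fun i _ => ?_
    rw [Finset.mul_sum]
    exact Finset.sum_congr rfl fun j _ => by ring
  have h2 : ∑ i, Γ i * u i * ∑ j, Γ j / (t i - t j) =
      ∑ i, ∑ j, Γ i * Γ j * (-u j / (t i - t j)) := by
    rw [h1, Finset.sum_comm]
    refine Finset.sum_congr rfl fun i _ => Finset.sum_congr rfl fun j _ => ?_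
    rw [← neg_sub (t i) (t j), div_neg, neg_div]
    ring
  rw [two_mul]
  nth_rewrite 1 [h1]
  rw [h2, ← Finset.sum_add_distrib]
  refine Finset.sum_congr rfl fun i _ => ?_
  rw [← Finset.sum_add_distrib]
  exact Finset.sum_congr rfl fun j _ => by ring

/-- Testing the equations against t - c gives 2ω ∑ Γ i (t i - c)² = ∑_{i ≠ j} Γ i Γ j > 0. -/
theorem angularVelocity_pos {n : ℕ} {Γ t : Fin n → ℝ} (hΓ : ∀ i, 0 < Γ i)
    (ht : Function.Injective t) {c ω : ℝ}
    (h : ∀ i, ω * (t i - c) = ∑ j, Γ j / (t i - t j)) (hn : 2 ≤ n) : 0 < ω := by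
  have h1 := sum_mul_sum_div_sub Γ t (fun i => t i - c)
  simp only [← h, sub_sub_sub_cancel_right] at h1
  have hnn : ∀ i j, 0 ≤ Γ i * Γ j * ((t i - t j) / (t i - t j)) := fun i j =>
    mul_nonneg (mul_pos (hΓ i) (hΓ j)).le (by
      rcases eq_or_ne (t i - t j) 0 with h0 | h0
      · simp [h0]
      · simp [div_self h0])
  have h2 : 0 < ∑ i, ∑ j, Γ i * Γ j * ((t i - t j) / (t i - t j)) := by
    refine Finset.sum_pos' (fun i _ => Finset.sum_nonneg fun j _ => hnn i j)
      ⟨⟨0, by omega⟩, Finset.mem_univ _, ?_⟩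
    refine Finset.sum_pos' (fun j _ => hnn _ j) ⟨⟨1, by omega⟩, Finset.mem_univ _, ?_⟩
    have h01 : t ⟨0, by omega⟩ - t ⟨1, by omega⟩ ≠ 0 :=
      sub_ne_zero.2 fun h => by simpa using ht h
    rw [div_self h01, mul_one]
    exact mul_pos (hΓ _) (hΓ _)
  have h3 : ∑ i, Γ i * (t i - c) * (ω * (t i - c)) = ω * ∑ i, Γ i * (t i - c) ^ 2 := by
    rw [Finset.mul_sum]
    exact Finset.sum_congr rfl fun i _ => by ring
  rw [h3] at h1
  have h4 : 0 ≤ ∑ i, Γ i * (t i - c) ^ 2 :=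
    Finset.sum_nonneg fun i _ => mul_nonneg (hΓ i).le (sq_nonneg _)
  by_contra hneg
  nlinarith [mul_nonneg (neg_nonneg.2 (not_lt.1 hneg)) h4]

/-- Positive strengths: the normalized equations have at most one solution in each ordering. -/
theorem normalized_unique {n : ℕ} {Γ t t' : Fin n → ℝ} (hΓ : ∀ i, 0 < Γ i)
    (hlt : ∀ i j, i ≠ j → 0 < (t i - t j) * (t' i - t' j))
    (h : ∀ i, t i = ∑ j, Γ j / (t i - t j)) (h' : ∀ i, t' i = ∑ j, Γ j / (t' i - t' j)) :
    t = t' := by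
  have h1 := sum_mul_sum_div_sub Γ t (fun i => t i - t' i)
  have h2 := sum_mul_sum_div_sub Γ t' (fun i => t i - t' i)
  simp only [← h] at h1
  simp only [← h'] at h2
  -- Both systems are tested against t - t' and subtracted. Within one ordering the interaction is a
  -- monotone (concave logarithmic) one, so every term on the right is nonpositive.
  have h3 : 2 * ∑ i, Γ i * (t i - t' i) ^ 2 ≤ 0 := by
    have e : 2 * ∑ i, Γ i * (t i - t' i) ^ 2 =
        2 * ∑ i, Γ i * (t i - t' i) * t i - 2 * ∑ i, Γ i * (t i - t' i) * t' i := by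
      rw [← mul_sub, ← Finset.sum_sub_distrib]
      congr 1
      exact Finset.sum_congr rfl fun i _ => by ring
    rw [e, h1, h2, ← Finset.sum_sub_distrib]
    refine Finset.sum_nonpos fun i _ => ?_
    rw [← Finset.sum_sub_distrib]
    refine Finset.sum_nonpos fun j _ => ?_
    rcases eq_or_ne i j with rfl | hij
    · simp
    · have hp := hlt i j hij
      have hd : t i - t j ≠ 0 := left_ne_zero_of_mul hp.ne'
      have hd' : t' i - t' j ≠ 0 := right_ne_zero_of_mul hp.ne'
      have : Γ i * Γ j * ((t i - t' i - (t j - t' j)) / (t i - t j)) -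
          Γ i * Γ j * ((t i - t' i - (t j - t' j)) / (t' i - t' j)) =
          -(Γ i * Γ j * (t i - t' i - (t j - t' j)) ^ 2 / ((t i - t j) * (t' i - t' j))) := by
        field_simp
        ring
      rw [this, neg_nonpos]
      have := hΓ i
      have := hΓ j
      positivity
  have hnn : ∀ i ∈ Finset.univ, 0 ≤ Γ i * (t i - t' i) ^ 2 :=
    fun i _ => mul_nonneg (hΓ i).le (sq_nonneg _)
  have h0 : ∑ i, Γ i * (t i - t' i) ^ 2 = 0 :=
    le_antisymm (by linarith) (Finset.sum_nonneg hnn)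
  funext i
  have := (Finset.sum_eq_zero_iff_of_nonneg hnn).1 h0 i (Finset.mem_univ _)
  have := (mul_eq_zero.1 this).resolve_left (hΓ i).ne'
  exact sub_eq_zero.1 (pow_eq_zero_iff two_ne_zero |>.1 this)

/-- A collinear relative equilibrium of positive vortices is equivalent to a solution on the real
line of the equations with centre `0` and angular velocity `1`. -/
theorem exists_normalized {n : ℕ} {Γ : Fin n → ℝ} (hΓ : ∀ i, 0 < Γ i) (hn : 2 ≤ n)
    {σ : Equiv.Perm (Fin n)} {x : VortexConfig n} (hx : IsRelativeEquilibrium Γ x)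
    (ho : HasOrdering σ x) : ∃ t : Fin n → ℝ, StrictMono (t ∘ σ) ∧
      (configSetoid n).r x (fun i => (t i : ℂ)) ∧ ∀ i, t i = ∑ j, Γ j / (t i - t j) := by
  obtain ⟨p, v, s, hv, hs, hp⟩ := ho
  have hr : (configSetoid n).r x (fun i => ((s (σ.symm i) : ℝ) : ℂ)) :=
    (configSetoid n).symm (configSetoid_ofReal (p := p) hv fun i => by
      rw [← hp, Equiv.apply_symm_apply])
  obtain ⟨hinj, c, ω, -, h⟩ := (isRelativeEquilibrium_ofReal_iff Γ _).1 (hx.of_equiv hr)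
  have hpos := angularVelocity_pos hΓ hinj h hn
  have hq : 0 < √ω := Real.sqrt_pos.2 hpos
  -- Scaling lengths by √ω divides the angular velocity by ω, which is possible because ω > 0.
  refine ⟨fun i => √ω * (s (σ.symm i) - c), fun i j hij => ?_, (configSetoid n).trans hr
    ⟨√ω, -(√ω * c), by exact_mod_cast hq.ne', fun i => by push_cast; ring⟩, fun i => ?_⟩
  · simpa using mul_lt_mul_of_pos_left (sub_lt_sub_right (hs hij) c) hq
  · have e : ∀ j, Γ j / (√ω * (s (σ.symm i) - c) - √ω * (s (σ.symm j) - c)) =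
        (√ω)⁻¹ * (Γ j / (s (σ.symm i) - s (σ.symm j))) := fun j => by
      rw [← mul_sub, sub_sub_sub_cancel_right, div_eq_mul_inv, mul_inv, div_eq_mul_inv]
      ring
    simp only [e]
    rw [← Finset.mul_sum, ← h, ← mul_assoc, inv_mul_eq_div, Real.div_sqrt]

theorem equiv_of_hasOrdering {n : ℕ} {Γ : Fin n → ℝ} (hΓ : ∀ i, 0 < Γ i) (hn : 2 ≤ n)
    {σ : Equiv.Perm (Fin n)} {x y : VortexConfig n} (hx : IsRelativeEquilibrium Γ x)
    (hox : HasOrdering σ x) (hy : IsRelativeEquilibrium Γ y) (hoy : HasOrdering σ y) :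
    (configSetoid n).r x y := by
  obtain ⟨t, ht, hxt, h⟩ := exists_normalized hΓ hn hx hox
  obtain ⟨t', ht', hyt, h'⟩ := exists_normalized hΓ hn hy hoy
  have : t = t' := by
    refine normalized_unique hΓ (fun i j hij => ?_) h h'
    rcases lt_or_gt_of_ne (fun e => hij (σ.symm.injective e) : σ.symm i ≠ σ.symm j) with hl | hl
    · have h1 := ht hl
      have h2 := ht' hl
      simp only [Function.comp_apply, Equiv.apply_symm_apply] at h1 h2
      exact mul_pos_of_neg_of_neg (sub_neg.2 h1) (sub_neg.2 h2)
    · have h1 := ht hl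
      have h2 := ht' hl
      simp only [Function.comp_apply, Equiv.apply_symm_apply] at h1 h2
      exact mul_pos (sub_pos.2 h1) (sub_pos.2 h2)
  subst this
  exact (configSetoid n).trans hxt ((configSetoid n).symm hyt)

/-! ### The equations in terms of pair midpoints and half-distances -/

/-- The collinear configuration in which the midpoints of the two pairs are `0` and `h` and the
half-distances are `s` and `r`. -/
noncomputable def pairConfig (h s r : ℝ) : VortexConfig 4 :=
  fun i => ((![s, -s, h + r, h - r] i : ℝ) : ℂ)

theorem pairConfig_injective_iff (h s r : ℝ) :
    Function.Injective (![s, -s, h + r, h - r] : Fin 4 → ℝ) ↔ s ≠ 0 ∧ r ≠ 0 ∧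
      s - (h + r) ≠ 0 ∧ s - (h - r) ≠ 0 ∧ -s - (h + r) ≠ 0 ∧ -s - (h - r) ≠ 0 := by
  constructor
  · intro hi
    refine ⟨fun e => ?_, fun e => ?_, fun e => ?_, fun e => ?_, fun e => ?_, fun e => ?_⟩
    · exact absurd (@hi 0 1 (by simp [e])) (by decide)
    · exact absurd (@hi 2 3 (by simp [e])) (by decide)
    · exact absurd (@hi 0 2 (by simpa using sub_eq_zero.1 e)) (by decide)
    · exact absurd (@hi 0 3 (by simpa using sub_eq_zero.1 e)) (by decide)
    · exact absurd (@hi 1 2 (by simpa using sub_eq_zero.1 e)) (by decide)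
    · exact absurd (@hi 1 3 (by simpa using sub_eq_zero.1 e)) (by decide)
  · rintro ⟨h1, h2, h3, h4, h5, h6⟩ i j hij
    by_contra hne
    fin_cases i <;> fin_cases j <;> simp at hij hne <;>
      first
      | exact h1 (by linarith) | exact h2 (by linarith) | exact h3 (by linarith)
      | exact h4 (by linarith) | exact h5 (by linarith) | exact h6 (by linarith)

theorem isRelativeEquilibrium_pairConfig_iff (m h s r : ℝ) :
    IsRelativeEquilibrium (pairStrengths m) (pairConfig h s r) ↔
      (s ≠ 0 ∧ r ≠ 0 ∧
        s - (h + r) ≠ 0 ∧ s - (h - r) ≠ 0 ∧ -s - (h + r) ≠ 0 ∧ -s - (h - r) ≠ 0) ∧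
      ∃ c ω : ℝ, ω ≠ 0 ∧
        ω * (s - c) = 1 / (2 * s) + m / (s - (h + r)) + m / (s - (h - r)) ∧
        ω * (-s - c) = -(1 / (2 * s)) + m / (-s - (h + r)) + m / (-s - (h - r)) ∧
        ω * (h + r - c) = -(1 / (s - (h + r))) - 1 / (-s - (h + r)) + m / (2 * r) ∧
        ω * (h - r - c) = -(1 / (s - (h - r))) - 1 / (-s - (h - r)) - m / (2 * r) := by
  unfold pairConfig
  rw [isRelativeEquilibrium_ofReal_iff, pairConfig_injective_iff]
  refine and_congr_right fun _ => exists_congr fun c => exists_congr fun ω =>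
    and_congr_right fun _ => ?_
  have e1 : -s - s = -(2 * s) := by ring
  have e2 : s - -s = 2 * s := by ring
  have e3 : h + r - (h - r) = 2 * r := by ring
  have e4 : h - r - (h + r) = -(2 * r) := by ring
  have e5 : ∀ u w : ℝ, 1 / (u - w) = -(1 / (w - u)) := fun u w => by
    rw [← neg_sub w u, div_neg]
  have e6 : ∀ P : Fin 4 → Prop, (∀ i, P i) ↔ P 0 ∧ P 1 ∧ P 2 ∧ P 3 := fun P => by
    simp [Fin.forall_fin_succ]
  rw [e6]
  simp only [Fin.sum_univ_four, pairStrengths, Matrix.cons_val_zero,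
    Matrix.cons_val_one, Matrix.cons_val, sub_self, div_zero,
    e1, e2, e3, e4, zero_add, add_zero, div_neg]
  rw [e5 (h + r) s, e5 (h + r) (-s), e5 (h - r) s, e5 (h - r) (-s)]
  simp only [sub_eq_add_neg]

theorem eq_iff_mul_eq_of_mul_eq {u v w d : ℝ} (hd : d ≠ 0) (h : v * d = w) :
    u = v ↔ u * d = w := by
  rw [← h, mul_left_inj' hd]

/-- Denominators are cleared, and the centre is made explicit: it must be the centre of vorticity,
because the interactions cancel in the strength-weighted sum of the equations. -/
theorem isRelativeEquilibrium_pairConfig_iff' (m h s r : ℝ) :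
    IsRelativeEquilibrium (pairStrengths m) (pairConfig h s r) ↔
      (s ≠ 0 ∧ r ≠ 0 ∧
        s - (h + r) ≠ 0 ∧ s - (h - r) ≠ 0 ∧ -s - (h + r) ≠ 0 ∧ -s - (h - r) ≠ 0) ∧
      ∃ c ω : ℝ, ω ≠ 0 ∧ c * (1 + m) = m * h ∧
        ω * (s - c) * (2 * s * ((s - h) ^ 2 - r ^ 2)) =
          (s - h) ^ 2 - r ^ 2 + 4 * m * s * (s - h) ∧
        ω * (-s - c) * (-(2 * s) * ((s + h) ^ 2 - r ^ 2)) =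
          (s + h) ^ 2 - r ^ 2 + 4 * m * s * (s + h) ∧
        ω * (h + r - c) * (2 * r * ((h + r) ^ 2 - s ^ 2)) =
          m * ((h + r) ^ 2 - s ^ 2) + 4 * r * (h + r) ∧
        ω * (h - r - c) * (-(2 * r) * ((h - r) ^ 2 - s ^ 2)) =
          m * ((h - r) ^ 2 - s ^ 2) - 4 * r * (h - r) := by
  rw [isRelativeEquilibrium_pairConfig_iff]
  refine and_congr_right fun ⟨h1, h2, h3, h4, h5, h6⟩ => exists_congr fun c => exists_congr fun ω =>
    and_congr_right fun hω => ?_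
  have f0 : (s - h) ^ 2 - r ^ 2 = (s - (h + r)) * (s - (h - r)) := by ring
  have f1 : (s + h) ^ 2 - r ^ 2 = (-s - (h + r)) * (-s - (h - r)) := by ring
  have f2 : (h + r) ^ 2 - s ^ 2 = (s - (h + r)) * (-s - (h + r)) := by ring
  have f3 : (h - r) ^ 2 - s ^ 2 = (s - (h - r)) * (-s - (h - r)) := by ring
  rw [f0, f1, f2, f3]
  have hs : 2 * s ≠ 0 := mul_ne_zero two_ne_zero h1
  have hr : 2 * r ≠ 0 := mul_ne_zero two_ne_zero h2
  have i0 := eq_iff_mul_eq_of_mul_eq (u := ω * (s - c)) (mul_ne_zero hs (mul_ne_zero h3 h4))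
    (show (1 / (2 * s) + m / (s - (h + r)) + m / (s - (h - r))) *
      (2 * s * ((s - (h + r)) * (s - (h - r)))) =
      (s - (h + r)) * (s - (h - r)) + 4 * m * s * (s - h) by field_simp; ring)
  have i1 := eq_iff_mul_eq_of_mul_eq (u := ω * (-s - c))
    (mul_ne_zero (neg_ne_zero.2 hs) (mul_ne_zero h5 h6))
    (show (-(1 / (2 * s)) + m / (-s - (h + r)) + m / (-s - (h - r))) *
      (-(2 * s) * ((-s - (h + r)) * (-s - (h - r)))) =
      (-s - (h + r)) * (-s - (h - r)) + 4 * m * s * (s + h) by field_simp; ring)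
  have i2 := eq_iff_mul_eq_of_mul_eq (u := ω * (h + r - c)) (mul_ne_zero hr (mul_ne_zero h3 h5))
    (show (-(1 / (s - (h + r))) - 1 / (-s - (h + r)) + m / (2 * r)) *
      (2 * r * ((s - (h + r)) * (-s - (h + r)))) =
      m * ((s - (h + r)) * (-s - (h + r))) + 4 * r * (h + r) by field_simp; ring)
  have i3 := eq_iff_mul_eq_of_mul_eq (u := ω * (h - r - c))
    (mul_ne_zero (neg_ne_zero.2 hr) (mul_ne_zero h4 h6))
    (show (-(1 / (s - (h - r))) - 1 / (-s - (h - r)) - m / (2 * r)) *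
      (-(2 * r) * ((s - (h - r)) * (-s - (h - r)))) =
      m * ((s - (h - r)) * (-s - (h - r))) - 4 * r * (h - r) by field_simp; ring)
  rw [← i0, ← i1, ← i2, ← i3]
  refine ⟨fun ⟨p0, p1, p2, p3⟩ => ⟨?_, p0, p1, p2, p3⟩, fun ⟨_, p⟩ => p⟩
  have : ω * (c * (1 + m) - m * h) = 0 := by
    linear_combination (-1 / 2) * p0 - 1 / 2 * p1 - m / 2 * p2 - m / 2 * p3
  exact sub_eq_zero.1 ((mul_eq_zero.1 this).resolve_left hω)

theorem isRelativeEquilibrium_pairConfig_zero_iff {m : ℝ} (hm : -1 < m) (s : ℝ) :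
    IsRelativeEquilibrium (pairStrengths m) (pairConfig 0 s 1) ↔
      m * (s ^ 2) ^ 2 - 5 * (1 + m) * s ^ 2 + 1 = 0 := by
  rw [isRelativeEquilibrium_pairConfig_iff']
  constructor
  · rintro ⟨-, c, ω, hω, hc, p0, p1, p2, p3⟩
    have hc0 : c = 0 := by
      have : (1 + m) ≠ 0 := by linarith
      simpa [this] using hc
    subst hc0
    linear_combination p0 + s ^ 2 * p2
  · intro h
    have hs : s ≠ 0 := by rintro rfl; norm_num at h
    have d : s ^ 2 - 1 ≠ 0 := fun e => by
      have : s ^ 2 = 1 := by linarith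
      rw [this] at h
      linarith
    have d' : (s - 1) * (s + 1) ≠ 0 := by rwa [show (s - 1) * (s + 1) = s ^ 2 - 1 by ring]
    have hd := left_ne_zero_of_mul d'
    have hd' := right_ne_zero_of_mul d'
    -- With c = 0, this value of ω is the one forced by the equation of the third vortex.
    refine ⟨⟨hs, one_ne_zero, by simpa using hd, by simpa using hd', fun e => hd' (by linarith),
      fun e => hd (by linarith)⟩, 0, (m * (s ^ 2 - 1) - 4) / (2 * (s ^ 2 - 1)), ?_, by simp, ?_⟩
    · refine div_ne_zero (fun e => ?_) (mul_ne_zero two_ne_zero d)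
      -- If ω vanished, then m (s² - 1) = 4, and the quartic would give a negative s².
      have : s ^ 2 = -4 * m - 15 := by linear_combination (-h) + (s ^ 2 - 4) * e
      nlinarith [sq_nonneg s]
    · refine ⟨?_, ?_, ?_, ?_⟩ <;> field_simp
      · linear_combination (s ^ 2 - 1) * h
      · linear_combination (s ^ 2 - 1) * h
      · ring
      · ring

/-- Sums and differences of the equations within each pair separate the parities in s and r. The
differences (`E2`, `E4`) determine s² and r² as affine functions of 1/ω; the sum for the second pair
(`E3`) then constrains ω. -/
theorem isRelativeEquilibrium_pairConfig_one_imp {m : ℝ} (hm : -1 < m) {s r : ℝ}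
    (h : IsRelativeEquilibrium (pairStrengths m) (pairConfig 1 s r)) :
    s ≠ 0 ∧ r ≠ 0 ∧ ∃ z : ℝ, (25 * (1 + m) ^ 2 + 8 * (1 + m) - 8) * z ^ 2 = 1 ∧
      2 * (1 + m) * s ^ 2 = 1 + m + (5 * (1 + m) ^ 2 - 2) * z ∧
      2 * (1 + m) * r ^ 2 = 1 + m + (3 * (1 + m) ^ 2 + 4 * (1 + m) - 2) * z := by
  obtain ⟨⟨h1, h2, -⟩, c, ω, hω, hc, p0, p1, p2, p3⟩ :=
    (isRelativeEquilibrium_pairConfig_iff' _ _ _ _).1 h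
  have hM : 1 + m ≠ 0 := by linarith
  refine ⟨h1, h2, ?_⟩
  clear h
  obtain ⟨M, rfl⟩ : ∃ M, m = M - 1 := ⟨1 + m, by ring⟩
  rw [add_sub_cancel] at *
  have E2 : M * (2 * M - 1) = ω * ((M - 1) * (s ^ 2 + 1 - r ^ 2) + 2 * M * s ^ 2) := by
    refine mul_left_cancel₀ h1 ?_
    linear_combination (M / 4) * (p0 - p1) + ω * (s ^ 2 + 1 - r ^ 2) * s * hc
  have E4 : M * (M + 1) = ω * (r ^ 2 + 1 - s ^ 2 + 2 * M * r ^ 2) := by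
    refine mul_left_cancel₀ h2 ?_
    linear_combination (-M / 4) * (p2 - p3) - ω * (r ^ 2 + 1 - s ^ 2) * r * hc
  have E3 : M * ((M - 1) * (r ^ 2 + 1 - s ^ 2) + 4 * r ^ 2) =
      2 * ω * r ^ 2 * (M * (r ^ 2 + 1 - s ^ 2) + 2) := by
    linear_combination (-M / 2) * (p2 + p3) - 4 * ω * r ^ 2 * hc
  -- An affine change of the unknown 1/ω, centred so that the final quadratic in z has no linear
  -- term.
  obtain ⟨z, hz⟩ : ∃ z, ω * (1 + 3 * M * z) = M := ⟨(M / ω - 1) / (3 * M), by field_simp; ring⟩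
  have ha : 2 * M * s ^ 2 = M + (5 * M ^ 2 - 2) * z := by
    refine mul_left_cancel₀ (mul_ne_zero (mul_ne_zero three_ne_zero hM) hω) ?_
    linear_combination (-(2 * M + 1)) * E2 - (M - 1) * E4 - (5 * M ^ 2 - 2) * hz
  have hb : 2 * M * r ^ 2 = M + (3 * M ^ 2 + 4 * M - 2) * z := by
    refine mul_left_cancel₀ (mul_ne_zero (mul_ne_zero three_ne_zero hM) hω) ?_
    linear_combination (-1) * E2 - (3 * M - 1) * E4 - (3 * M ^ 2 + 4 * M - 2) * hz
  refine ⟨z, ?_, ha, hb⟩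
  have hk : r ^ 2 = s ^ 2 - (M - 2) * z := by
    refine mul_left_cancel₀ (mul_ne_zero two_ne_zero hM) ?_
    linear_combination hb - ha
  refine mul_left_cancel₀ hM ?_
  linear_combination (1 + 3 * M * z) * E3 + 2 * r ^ 2 * (M * (r ^ 2 + 1 - s ^ 2) + 2) * hz -
    M * ((-1 + (M + 4) * z) * hb + ((M - 1) * (1 + 3 * M * z) - 2 * M * r ^ 2) * hk)

/-- The elimination is reversible as long as no vortices collide and 1 + 3Mz ≠ 0; both hold because
(2M - 1)(M + 1) ≠ 0. -/
theorem isRelativeEquilibrium_pairConfig_one_of {m : ℝ} (hm : -1 / 2 < m) {s r z : ℝ}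
    (hs : s ≠ 0) (hr : r ≠ 0) (hz : (25 * (1 + m) ^ 2 + 8 * (1 + m) - 8) * z ^ 2 = 1)
    (ha : 2 * (1 + m) * s ^ 2 = 1 + m + (5 * (1 + m) ^ 2 - 2) * z)
    (hb : 2 * (1 + m) * r ^ 2 = 1 + m + (3 * (1 + m) ^ 2 + 4 * (1 + m) - 2) * z) :
    IsRelativeEquilibrium (pairStrengths m) (pairConfig 1 s r) := by
  rw [isRelativeEquilibrium_pairConfig_iff']
  obtain ⟨M, rfl⟩ : ∃ M, m = M - 1 := ⟨1 + m, by ring⟩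
  rw [add_sub_cancel] at *
  have hM : 1 / 2 < M := by linarith
  have hM0 : M ≠ 0 := by linarith
  have hz0 : z ≠ 0 := by rintro rfl; norm_num at hz
  have hn : 1 + 3 * M * z ≠ 0 := fun e => by
    -- If 3Mz = -1, comparison with the equation for z gives 25M² + 8M - 8 = 9M².
    have : (2 * M - 1) * (M + 1) = 0 := by
      linear_combination (9 * M ^ 2 * hz - (25 * M ^ 2 + 8 * M - 8) * (3 * M * z - 1) * e) / 8
    rcases mul_eq_zero.1 this with h | h <;> linarith
  have hk : r ^ 2 = s ^ 2 - (M - 2) * z := by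
    refine mul_left_cancel₀ (mul_ne_zero two_ne_zero hM0) ?_
    linear_combination hb - ha
  -- The product of the four distances between vortices of different pairs, up to sign, in terms of
  -- z; it vanishes at M = 1/2.
  have hD : (s - (1 + r)) * (s - (1 - r)) * (-s - (1 + r)) * (-s - (1 - r)) * M =
      -4 * (2 * M - 1) * (M + 1) * z * (1 + 3 * M * z) := by
    linear_combination M * hz - ha - hb + M * (r ^ 2 - s ^ 2 - (M - 2) * z) * hk
  have hD0 : (s - (1 + r)) * (s - (1 - r)) * (-s - (1 + r)) * (-s - (1 - r)) * M ≠ 0 := by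
    rw [hD]
    have h1 : 2 * M - 1 ≠ 0 := by linarith
    have h2 : M + 1 ≠ 0 := by linarith
    positivity
  have d1 := left_ne_zero_of_mul hD0
  have d2 := left_ne_zero_of_mul d1
  have d3 := left_ne_zero_of_mul d2
  obtain ⟨c, hc⟩ : ∃ c, c * M = M - 1 := ⟨(M - 1) / M, by field_simp⟩
  obtain ⟨ω, hω⟩ : ∃ ω, ω * (1 + 3 * M * z) = M := ⟨_, div_mul_cancel₀ M hn⟩
  have hω0 : ω ≠ 0 := by rintro rfl; exact hM0 (by linarith)
  refine ⟨⟨hs, hr, left_ne_zero_of_mul d3, right_ne_zero_of_mul d3, right_ne_zero_of_mul d2,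
    right_ne_zero_of_mul d1⟩, c, ω, hω0, by linarith, ?_⟩
  have E2 : (2 * M - 1) * (1 + 3 * M * z) = (M - 1) * (s ^ 2 + 1 - r ^ 2) + 2 * M * s ^ 2 := by
    linear_combination (M - 1) * hk - ha
  have E4 : (M + 1) * (1 + 3 * M * z) = r ^ 2 + 1 - s ^ 2 + 2 * M * r ^ 2 := by
    linear_combination -hk - hb
  have E3 : ((M - 1) * (r ^ 2 + 1 - s ^ 2) + 4 * r ^ 2) * (1 + 3 * M * z) =
      2 * r ^ 2 * (M * (r ^ 2 + 1 - s ^ 2) + 2) := by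
    linear_combination hz + (-1 + (M + 4) * z) * hb +
      ((M - 1) * (1 + 3 * M * z) - 2 * M * r ^ 2) * hk
  have E1 : (s ^ 2 + 1 - r ^ 2 + 4 * (M - 1) * s ^ 2) * (1 + 3 * M * z) =
      2 * s ^ 2 * (M * (s ^ 2 + 1 - r ^ 2) + 2 * (M - 1)) := by
    linear_combination (M - 1) * hz + (-1 + (5 * M - 4) * z) * ha -
      (1 + 3 * M * z - 2 * M * s ^ 2) * hk
  refine ⟨?_, ?_, ?_, ?_⟩ <;> refine mul_left_cancel₀ hn ?_
  · linear_combination -E1 + 2 * s * E2 + 2 * s * ((s - 1) ^ 2 - r ^ 2) * ((s - c) * hω - hc)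
  · linear_combination -E1 - 2 * s * E2 - 2 * s * ((s + 1) ^ 2 - r ^ 2) * ((-s - c) * hω - hc)
  · linear_combination -E3 - 2 * r * E4 + 2 * r * ((1 + r) ^ 2 - s ^ 2) * ((1 + r - c) * hω - hc)
  · linear_combination -E3 + 2 * r * E4 - 2 * r * ((1 - r) ^ 2 - s ^ 2) * ((1 - r - c) * hω - hc)

/-! ### Normal forms for the equivalence classes -/

theorem pairConfig_equiv {h s r h' s' r' : ℝ}
    (e : (configSetoid 4).r (pairConfig h s r) (pairConfig h' s' r')) :
    ∃ a : ℂ, a ≠ 0 ∧ (h' : ℂ) = a * h ∧ (s' : ℂ) = a * s ∧ (r' : ℂ) = a * r := by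
  obtain ⟨a, b, ha, hab⟩ := e
  have e0 := hab 0
  have e1 := hab 1
  have e2 := hab 2
  have e3 := hab 3
  simp only [pairConfig, Matrix.cons_val_zero, Matrix.cons_val_one, Matrix.cons_val] at e0 e1 e2 e3
  push_cast at e0 e1 e2 e3
  refine ⟨a, ha, ?_, ?_, ?_⟩
  · linear_combination (e2 + e3 - e0 - e1) / 2
  · linear_combination (e0 - e1) / 2
  · linear_combination (e2 - e3) / 2

theorem pairConfig_collinear (h s r : ℝ) : Collinear ℝ (Set.range (pairConfig h s r)) :=
  collinear_of_real_equiv (p := 0) (v := 1) (t := ![s, -s, h + r, h - r]) fun i => by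
    simp [pairConfig]

theorem exists_equiv_pairConfig {x : VortexConfig 4} (hx : Function.Injective x)
    (hc : Collinear ℝ (Set.range x)) :
    (∃ s, (configSetoid 4).r (pairConfig 0 s 1) x) ∨
      ∃ s r, (configSetoid 4).r (pairConfig 1 s r) x := by
  obtain ⟨p, v, t, hv, ht, h⟩ := exists_real_equiv_of_collinear hx hc
  have hxt : (configSetoid 4).r (fun i => (t i : ℂ)) x := configSetoid_ofReal hv h
  have key : ∀ a h s r : ℝ, a ≠ 0 → a * s = (t 0 - t 1) / 2 → a * r = (t 2 - t 3) / 2 →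
      a * h = (t 2 + t 3) / 2 - (t 0 + t 1) / 2 → (configSetoid 4).r (pairConfig h s r) x := by
    intro a h s r ha hs hr hh
    refine (configSetoid 4).trans ⟨a, ((t 0 + t 1) / 2 : ℝ), by exact_mod_cast ha, fun i => ?_⟩ hxt
    simp only [pairConfig]
    norm_cast
    fin_cases i <;> simp <;> linarith
  by_cases hh : (t 2 + t 3) / 2 - (t 0 + t 1) / 2 = 0
  · have hr : (t 2 - t 3) / 2 ≠ 0 := fun e => by
      have := @ht 2 3 (by linarith)
      exact absurd this (by decide)
    exact Or.inl ⟨_, key _ 0 (((t 0 - t 1) / 2) / ((t 2 - t 3) / 2)) 1 hr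
      (mul_div_cancel₀ _ hr) (mul_one _) (by rw [hh, mul_zero])⟩
  · exact Or.inr ⟨_, _, key _ 1 _ _ hh (mul_div_cancel₀ _ hh) (mul_div_cancel₀ _ hh) (mul_one _)⟩

/-- The triple (h, s, r) is determined by the class up to a common factor. Normalizing h = 1, or r =
1 when h = 0, fixes that factor, so the two families parametrize the classes without repetition. -/
theorem encard_configClasses {S : Set (VortexConfig 4)}
    (hinj : ∀ x ∈ S, Function.Injective x) (hcol : ∀ x ∈ S, Collinear ℝ (Set.range x))
    (hS : ∀ x y, (configSetoid 4).r x y → x ∈ S → y ∈ S) :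
    (configClasses S).encard = {s : ℝ | pairConfig 0 s 1 ∈ S}.encard +
      {p : ℝ × ℝ | pairConfig 1 p.1 p.2 ∈ S}.encard := by
  have himg : configClasses S =
      (fun s : ℝ => Quotient.mk (configSetoid 4) (pairConfig 0 s 1)) '' {s | pairConfig 0 s 1 ∈ S} ∪
      (fun p : ℝ × ℝ => Quotient.mk (configSetoid 4) (pairConfig 1 p.1 p.2)) ''
        {p | pairConfig 1 p.1 p.2 ∈ S} := by
    ext q
    constructor
    · rintro ⟨x, hx, rfl⟩
      rcases exists_equiv_pairConfig (hinj x hx) (hcol x hx) with ⟨s, hs⟩ | ⟨s, r, hs⟩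
      · exact Or.inl ⟨s, hS _ _ ((configSetoid 4).symm hs) hx, Quotient.sound hs⟩
      · exact Or.inr ⟨(s, r), hS _ _ ((configSetoid 4).symm hs) hx, Quotient.sound hs⟩
    · rintro (⟨s, hs, rfl⟩ | ⟨p, hp, rfl⟩)
      · exact ⟨_, hs, rfl⟩
      · exact ⟨_, hp, rfl⟩
  rw [himg, Set.encard_union_eq, Set.InjOn.encard_image, Set.InjOn.encard_image]
  · rintro ⟨s, r⟩ - ⟨s', r'⟩ - e
    obtain ⟨a, -, h1, h2, h3⟩ := pairConfig_equiv (Quotient.exact e)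
    have ha : a = 1 := by simpa using h1.symm
    subst ha
    rw [one_mul, Complex.ofReal_inj] at h2 h3
    exact Prod.ext h2.symm h3.symm
  · rintro s - s' - e
    obtain ⟨a, -, h1, h2, h3⟩ := pairConfig_equiv (Quotient.exact e)
    have ha : a = 1 := by simpa using h3.symm
    subst ha
    rw [one_mul, Complex.ofReal_inj] at h2
    exact h2.symm
  · rw [Set.disjoint_left]
    rintro _ ⟨s, -, rfl⟩ ⟨p, -, e⟩
    obtain ⟨a, ha, h1, -⟩ := pairConfig_equiv (Quotient.exact e)
    simp only [Complex.ofReal_one, mul_one, Complex.ofReal_zero] at h1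
    exact ha h1.symm

/-! ### Symmetry of the normal forms -/

theorem isSymmetricConfig_pairConfig_zero (s r : ℝ) : IsSymmetricConfig (pairConfig 0 s r) := by
  refine ⟨0, fun i => ⟨![1, 0, 3, 2] i, ?_⟩⟩
  fin_cases i <;> simp [pairConfig]

theorem isSymmetricConfig_pairConfig_one_iff {s r : ℝ}
    (hinj : Function.Injective (pairConfig 1 s r)) :
    IsSymmetricConfig (pairConfig 1 s r) ↔ s ^ 2 = r ^ 2 := by
  constructor
  · rintro ⟨p, hp⟩
    choose f hf using hp
    have hfinj : Function.Injective f := fun i j hij => hinj (by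
      have h1 := hf i
      rw [hij, hf j] at h1
      exact (sub_right_injective h1).symm)
    have hsum := Equiv.sum_comp (Equiv.ofBijective f (Finite.injective_iff_bijective.1 hfinj))
      (pairConfig 1 s r)
    simp only [Equiv.ofBijective_apply, hf, Fin.sum_univ_four] at hsum
    -- The reflection permutes the positions, so it fixes their centroid 1/2.
    have hp : 2 * p = 1 := by
      simp only [pairConfig, Matrix.cons_val_zero, Matrix.cons_val_one, Matrix.cons_val] at hsum
      push_cast at hsum
      linear_combination hsum / 4
    have h0 : (![s, -s, 1 + r, 1 - r] (f 0) : ℝ) = 1 - s := by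
      have := hf 0
      rw [hp] at this
      simp only [pairConfig, Matrix.cons_val_zero] at this
      exact_mod_cast this
    have h1 : (![s, -s, 1 + r, 1 - r] (f 1) : ℝ) = 1 + s := by
      have := hf 1
      rw [hp] at this
      simp only [pairConfig, Matrix.cons_val_one, Matrix.cons_val_zero, Complex.ofReal_neg,
        sub_neg_eq_add] at this
      exact_mod_cast this
    -- The image of one vortex alone would leave s = 1/2 or s = -1/2 possible; the images of both
    -- members of the first pair exclude these unless s = ±r.
    have hor : s = r ∨ s = -r := by
      generalize f 0 = i at h0
      generalize f 1 = j at h1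
      fin_cases i <;> fin_cases j <;> simp at h0 h1 <;>
        first
        | exact Or.inl (by linarith)
        | exact Or.inr (by linarith)
    exact sq_eq_sq_iff_eq_or_eq_neg.2 hor
  · intro h
    rcases sq_eq_sq_iff_eq_or_eq_neg.1 h with rfl | rfl
    · refine ⟨1 / 2, fun i => ⟨![3, 2, 1, 0] i, ?_⟩⟩
      fin_cases i <;> simp [pairConfig]
    · refine ⟨1 / 2, fun i => ⟨![2, 3, 0, 1] i, ?_⟩⟩
      fin_cases i <;> simp [pairConfig]

/-! ### Counting the real solutions -/

theorem pairConfig_zero_mem_iff {m : ℝ} (hm : -1 < m) (s : ℝ) :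
    pairConfig 0 s 1 ∈ collinearRelEq m ↔ m * (s ^ 2) ^ 2 - 5 * (1 + m) * s ^ 2 + 1 = 0 := by
  rw [← isRelativeEquilibrium_pairConfig_zero_iff hm]
  exact ⟨fun h => h.1, fun h => ⟨h, pairConfig_collinear _ _ _⟩⟩

theorem encard_sq_eq {u : ℝ} (hu : 0 < u) : {s : ℝ | s ^ 2 = u}.encard = 2 := by
  have h : {s : ℝ | s ^ 2 = u} = {√u, -√u} := by
    ext s
    rw [Set.mem_ofPred_eq, ← Real.sq_sqrt hu.le, sq_eq_sq_iff_eq_or_eq_neg]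
    simp [Real.sq_sqrt hu.le]
  rw [h, Set.encard_pair]
  have := Real.sqrt_pos.2 hu
  linarith

theorem encard_sq_eq_prod {a b : ℝ} (ha : 0 < a) (hb : 0 < b) :
    {p : ℝ × ℝ | p.1 ^ 2 = a ∧ p.2 ^ 2 = b}.encard = 4 := by
  have h : {p : ℝ × ℝ | p.1 ^ 2 = a ∧ p.2 ^ 2 = b} = {s | s ^ 2 = a} ×ˢ {s | s ^ 2 = b} := rfl
  rw [h, Set.encard_prod, encard_sq_eq ha, encard_sq_eq hb]
  norm_num

theorem encard_pairConfig_zero_of_pos {m : ℝ} (hm : 0 < m) :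
    {s : ℝ | pairConfig 0 s 1 ∈ collinearRelEq m}.encard = 4 := by
  have hd : 0 < 25 * (1 + m) ^ 2 - 4 * m := by nlinarith
  set δ := √(25 * (1 + m) ^ 2 - 4 * m) with hδ
  have hδ0 : 0 < δ := Real.sqrt_pos.2 hd
  have hδ2 : δ ^ 2 = 25 * (1 + m) ^ 2 - 4 * m := Real.sq_sqrt hd.le
  have hδ1 : δ < 5 * (1 + m) := by nlinarith
  have h : {s : ℝ | pairConfig 0 s 1 ∈ collinearRelEq m} =
      {s | s ^ 2 = (5 * (1 + m) + δ) / (2 * m)} ∪ {s | s ^ 2 = (5 * (1 + m) - δ) / (2 * m)} := by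
    ext s
    have := quadratic_eq_zero_iff (a := m) (b := -(5 * (1 + m))) (c := 1) hm.ne' (s := δ)
      (by rw [discrim]; linear_combination -hδ2) (s ^ 2)
    rw [neg_neg] at this
    rw [Set.mem_ofPred_eq, pairConfig_zero_mem_iff (by linarith), Set.mem_union, Set.mem_ofPred_eq,
      Set.mem_ofPred_eq, ← this]
    constructor <;> intro h <;> linear_combination h
  rw [h, Set.encard_union_eq, encard_sq_eq (by positivity),
    encard_sq_eq (div_pos (by linarith) (by linarith))]
  · norm_num
  · rw [Set.disjoint_left]
    intro s h1 h2
    rw [Set.mem_ofPred_eq] at h1 h2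
    rw [h1] at h2
    field_simp at h2
    linarith

theorem encard_pairConfig_zero_of_neg {m : ℝ} (hm : m < 0) (hm1 : -1 < m) :
    {s : ℝ | pairConfig 0 s 1 ∈ collinearRelEq m}.encard = 2 := by
  have hd : 0 < 25 * (1 + m) ^ 2 - 4 * m := by nlinarith
  set δ := √(25 * (1 + m) ^ 2 - 4 * m) with hδ
  have hδ0 : 0 < δ := Real.sqrt_pos.2 hd
  have hδ2 : δ ^ 2 = 25 * (1 + m) ^ 2 - 4 * m := Real.sq_sqrt hd.le
  have hδ1 : 5 * (1 + m) < δ := by nlinarith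
  have h : {s : ℝ | pairConfig 0 s 1 ∈ collinearRelEq m} =
      {s | s ^ 2 = (5 * (1 + m) - δ) / (2 * m)} := by
    ext s
    have := quadratic_eq_zero_iff (a := m) (b := -(5 * (1 + m))) (c := 1) hm.ne (s := δ)
      (by rw [discrim]; linear_combination -hδ2) (s ^ 2)
    rw [neg_neg] at this
    have hne : s ^ 2 ≠ (5 * (1 + m) + δ) / (2 * m) := fun e => by
      have : (5 * (1 + m) + δ) / (2 * m) < 0 := div_neg_of_pos_of_neg (by linarith) (by linarith)
      nlinarith [sq_nonneg s]
    rw [or_iff_right hne] at this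
    rw [Set.mem_ofPred_eq, pairConfig_zero_mem_iff (by linarith), Set.mem_ofPred_eq, ← this]
    constructor <;> intro h <;> linear_combination h
  rw [h, encard_sq_eq (div_pos_of_neg_of_neg (by linarith) (by linarith))]

theorem pairConfig_one_mem_iff {m : ℝ} (hm : -1 / 2 < m) (s r : ℝ) :
    pairConfig 1 s r ∈ collinearRelEq m ↔ s ≠ 0 ∧ r ≠ 0 ∧ ∃ z : ℝ,
      (25 * (1 + m) ^ 2 + 8 * (1 + m) - 8) * z ^ 2 = 1 ∧
      2 * (1 + m) * s ^ 2 = 1 + m + (5 * (1 + m) ^ 2 - 2) * z ∧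
      2 * (1 + m) * r ^ 2 = 1 + m + (3 * (1 + m) ^ 2 + 4 * (1 + m) - 2) * z :=
  ⟨fun h => isRelativeEquilibrium_pairConfig_one_imp (by linarith) h.1,
    fun ⟨hs, hr, _, hz, ha, hb⟩ =>
      ⟨isRelativeEquilibrium_pairConfig_one_of hm hs hr hz ha hb, pairConfig_collinear _ _ _⟩⟩

/-- The difference M² - ((5M² - 2) z)² is a positive multiple of 2M - 1. Hence s² > 0 for either
sign of z. -/
theorem first_halfDistance_sq_pos {M z : ℝ} (hM : 1 / 2 < M)
    (hz : (25 * M ^ 2 + 8 * M - 8) * z ^ 2 = 1) : 0 < M + (5 * M ^ 2 - 2) * z := by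
  have hz0 : 0 < z ^ 2 := by
    have : z ≠ 0 := by rintro rfl; norm_num at hz
    positivity
  have h : M ^ 2 - ((5 * M ^ 2 - 2) * z) ^ 2 = 4 * ((M + 1) ^ 2 * (2 * M - 1) * z ^ 2) := by
    linear_combination -M ^ 2 * hz
  have h1 : 0 < (M + 1) ^ 2 * (2 * M - 1) * z ^ 2 :=
    mul_pos (mul_pos (by positivity) (by linarith)) hz0
  have := abs_lt_of_sq_lt_sq' (show ((5 * M ^ 2 - 2) * z) ^ 2 < M ^ 2 by linarith) (by linarith)
  linarith [this.1]

/-- The sign of M - 1 decides whether the term in z can outweigh M in 2M r²: for M > 1 both signs of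
z give r² > 0, for 1/2 < M < 1 only one does. -/
theorem second_halfDistance_identity {M z : ℝ} (hz : (25 * M ^ 2 + 8 * M - 8) * z ^ 2 = 1) :
    M ^ 2 - ((3 * M ^ 2 + 4 * M - 2) * z) ^ 2 =
      4 * ((M - 1) * ((M + 1) * (2 * M - 1) ^ 2 * z ^ 2)) := by
  linear_combination -M ^ 2 * hz

/-- The solutions of the system for the asymmetric configurations with parameter `z`. -/
theorem halfDistances_setOf_eq {M z : ℝ} (hM : 0 < M) (A B : ℝ) :
    {p : ℝ × ℝ | 2 * M * p.1 ^ 2 = M + A * z ∧ 2 * M * p.2 ^ 2 = M + B * z} =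
      {p | p.1 ^ 2 = (M + A * z) / (2 * M) ∧ p.2 ^ 2 = (M + B * z) / (2 * M)} := by
  have h2 : 2 * M ≠ 0 := by positivity
  ext p
  simp only [Set.mem_ofPred_eq, eq_div_iff h2, mul_comm (2 * M)]

theorem encard_pairConfig_one_of_pos {m : ℝ} (hm : 0 < m) :
    {p : ℝ × ℝ | pairConfig 1 p.1 p.2 ∈ collinearRelEq m}.encard = 8 := by
  have hsub : ∀ p : ℝ × ℝ, pairConfig 1 p.1 p.2 ∈ collinearRelEq m ↔ _ :=
    fun p => pairConfig_one_mem_iff (by linarith) p.1 p.2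
  simp only [hsub]
  clear hsub
  obtain ⟨M, hM, hM1⟩ : ∃ M, 1 + m = M ∧ 1 < M := ⟨1 + m, rfl, by linarith⟩
  simp only [hM]
  have hS : 0 < 25 * M ^ 2 + 8 * M - 8 := by nlinarith
  obtain ⟨z₀, hz₀, hz⟩ : ∃ z, 0 < z ∧ (25 * M ^ 2 + 8 * M - 8) * z ^ 2 = 1 :=
    ⟨(√(25 * M ^ 2 + 8 * M - 8))⁻¹, by positivity, by
      rw [inv_pow, Real.sq_sqrt hS.le, mul_inv_cancel₀ hS.ne']⟩
  have hz' : (25 * M ^ 2 + 8 * M - 8) * (-z₀) ^ 2 = 1 := by rwa [neg_sq]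
  have hzz : ∀ z, (25 * M ^ 2 + 8 * M - 8) * z ^ 2 = 1 ↔ z = z₀ ∨ z = -z₀ := fun z => by
    rw [← hz, mul_right_inj' hS.ne', sq_eq_sq_iff_eq_or_eq_neg]
  have hA : ∀ z, z = z₀ ∨ z = -z₀ → 0 < M + (5 * M ^ 2 - 2) * z := fun z h =>
    first_halfDistance_sq_pos (by linarith) ((hzz z).2 h)
  have hB : ∀ z, z = z₀ ∨ z = -z₀ → 0 < M + (3 * M ^ 2 + 4 * M - 2) * z := fun z h => by
    have h1 := second_halfDistance_identity ((hzz z).2 h)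
    have h2 : 0 < (M - 1) * ((M + 1) * (2 * M - 1) ^ 2 * z ^ 2) := by
      have : z ^ 2 = z₀ ^ 2 := sq_eq_sq_iff_eq_or_eq_neg.2 h
      rw [this]
      have : 0 < M - 1 := by linarith
      have : 0 < 2 * M - 1 := by linarith
      positivity
    have := abs_lt_of_sq_lt_sq'
      (show ((3 * M ^ 2 + 4 * M - 2) * z) ^ 2 < M ^ 2 by linarith) (by linarith)
    linarith [this.1]
  have h : {p : ℝ × ℝ | p.1 ≠ 0 ∧ p.2 ≠ 0 ∧ ∃ z : ℝ, (25 * M ^ 2 + 8 * M - 8) * z ^ 2 = 1 ∧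
      2 * M * p.1 ^ 2 = M + (5 * M ^ 2 - 2) * z ∧
      2 * M * p.2 ^ 2 = M + (3 * M ^ 2 + 4 * M - 2) * z} =
      {p | 2 * M * p.1 ^ 2 = M + (5 * M ^ 2 - 2) * z₀ ∧
        2 * M * p.2 ^ 2 = M + (3 * M ^ 2 + 4 * M - 2) * z₀} ∪
      {p | 2 * M * p.1 ^ 2 = M + (5 * M ^ 2 - 2) * -z₀ ∧
        2 * M * p.2 ^ 2 = M + (3 * M ^ 2 + 4 * M - 2) * -z₀} := by
    ext ⟨s, r⟩
    simp only [Set.mem_ofPred_eq, Set.mem_union, hzz]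
    constructor
    · rintro ⟨-, -, z, rfl | rfl, h⟩
      · exact Or.inl h
      · exact Or.inr h
    · have key : ∀ z, z = z₀ ∨ z = -z₀ → 2 * M * s ^ 2 = M + (5 * M ^ 2 - 2) * z →
          2 * M * r ^ 2 = M + (3 * M ^ 2 + 4 * M - 2) * z → s ≠ 0 ∧ r ≠ 0 := by
        intro z hz h1 h2
        have := hA z hz
        have := hB z hz
        constructor <;> rintro rfl <;> simp at h1 h2 <;> linarith
      rintro (⟨h1, h2⟩ | ⟨h1, h2⟩)
      · exact ⟨(key _ (Or.inl rfl) h1 h2).1, (key _ (Or.inl rfl) h1 h2).2, _, Or.inl rfl, h1, h2⟩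
      · exact ⟨(key _ (Or.inr rfl) h1 h2).1, (key _ (Or.inr rfl) h1 h2).2, _, Or.inr rfl, h1, h2⟩
  have hM2 : 0 < 2 * M := by linarith
  rw [h, Set.encard_union_eq, halfDistances_setOf_eq (by linarith),
    halfDistances_setOf_eq (by linarith),
    encard_sq_eq_prod (div_pos (hA _ (Or.inl rfl)) hM2) (div_pos (hB _ (Or.inl rfl)) hM2),
    encard_sq_eq_prod (div_pos (hA _ (Or.inr rfl)) hM2) (div_pos (hB _ (Or.inr rfl)) hM2)]
  · norm_num
  · rw [Set.disjoint_left]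
    rintro p ⟨-, h1⟩ ⟨-, h2⟩
    have : (3 * M ^ 2 + 4 * M - 2) * z₀ = 0 := by linarith
    have : 0 < (3 * M ^ 2 + 4 * M - 2) * z₀ := mul_pos (by nlinarith) hz₀
    linarith

theorem encard_pairConfig_one_of_neg {m : ℝ} (hm : m < 0) (hm1 : -1 / 2 < m) :
    {p : ℝ × ℝ | pairConfig 1 p.1 p.2 ∈ collinearRelEq m}.encard = 4 := by
  have hsub : ∀ p : ℝ × ℝ, pairConfig 1 p.1 p.2 ∈ collinearRelEq m ↔ _ :=
    fun p => pairConfig_one_mem_iff hm1 p.1 p.2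
  simp only [hsub]
  clear hsub
  obtain ⟨M, hM, hM1, hM2⟩ : ∃ M, 1 + m = M ∧ 1 / 2 < M ∧ M < 1 :=
    ⟨1 + m, rfl, by linarith, by linarith⟩
  simp only [hM]
  have hM0 : 0 < M := by linarith
  have hS : 0 < 25 * M ^ 2 + 8 * M - 8 := by nlinarith
  have hB0 : 0 < 3 * M ^ 2 + 4 * M - 2 := by nlinarith
  obtain ⟨z₀, hz₀, hz⟩ : ∃ z, 0 < z ∧ (25 * M ^ 2 + 8 * M - 8) * z ^ 2 = 1 :=
    ⟨(√(25 * M ^ 2 + 8 * M - 8))⁻¹, by positivity, by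
      rw [inv_pow, Real.sq_sqrt hS.le, mul_inv_cancel₀ hS.ne']⟩
  have hA := first_halfDistance_sq_pos hM1 hz
  have hB : 0 < M + (3 * M ^ 2 + 4 * M - 2) * z₀ := by positivity
  -- This rules out z = -z₀, for which r² would be negative.
  have hB' : M < (3 * M ^ 2 + 4 * M - 2) * z₀ := by
    have h1 := second_halfDistance_identity hz
    have h2 : 0 < (1 - M) * ((M + 1) * (2 * M - 1) ^ 2 * z₀ ^ 2) := by
      have : 0 < 1 - M := by linarith
      have : 0 < 2 * M - 1 := by linarith
      positivity
    exact lt_of_pow_lt_pow_left₀ 2 (by positivity) (by linarith)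
  have h : {p : ℝ × ℝ | p.1 ≠ 0 ∧ p.2 ≠ 0 ∧ ∃ z : ℝ, (25 * M ^ 2 + 8 * M - 8) * z ^ 2 = 1 ∧
      2 * M * p.1 ^ 2 = M + (5 * M ^ 2 - 2) * z ∧
      2 * M * p.2 ^ 2 = M + (3 * M ^ 2 + 4 * M - 2) * z} =
      {p | 2 * M * p.1 ^ 2 = M + (5 * M ^ 2 - 2) * z₀ ∧
        2 * M * p.2 ^ 2 = M + (3 * M ^ 2 + 4 * M - 2) * z₀} := by
    ext ⟨s, r⟩
    simp only [Set.mem_ofPred_eq]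
    constructor
    · rintro ⟨-, -, z, h, h1, h2⟩
      rw [← hz, mul_right_inj' hS.ne', sq_eq_sq_iff_eq_or_eq_neg] at h
      rcases h with rfl | rfl
      · exact ⟨h1, h2⟩
      · have : 0 ≤ 2 * M * r ^ 2 := by positivity
        linarith
    · rintro ⟨h1, h2⟩
      refine ⟨?_, ?_, z₀, hz, h1, h2⟩ <;> rintro rfl <;> simp at h1 h2 <;> linarith
  rw [h, halfDistances_setOf_eq hM0,
    encard_sq_eq_prod (div_pos hA (by linarith)) (div_pos hB (by linarith))]

/-- For M ≤ 1/2 neither z-term is smaller than M in absolute value, so s², r² > 0 force both to be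
positive. As 5M² - 2 < 0, this requires z < 0 and 3M² + 4M - 2 < 0, which is incompatible with 25M²
+ 8M - 8 > 0. -/
theorem pairConfig_one_notMem {m : ℝ} (hm : -1 < m) (hm1 : m ≤ -1 / 2) (s r : ℝ) :
    pairConfig 1 s r ∉ collinearRelEq m := by
  intro h
  obtain ⟨hs, hr, z, hz, ha, hb⟩ := isRelativeEquilibrium_pairConfig_one_imp hm h.1
  obtain ⟨M, hM, hM0, hM1⟩ : ∃ M, 1 + m = M ∧ 0 < M ∧ M ≤ 1 / 2 :=
    ⟨1 + m, rfl, by linarith, by linarith⟩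
  rw [hM] at hz ha hb
  have hA : 0 < M + (5 * M ^ 2 - 2) * z := by rw [← ha]; positivity
  have hB : 0 < M + (3 * M ^ 2 + 4 * M - 2) * z := by rw [← hb]; positivity
  have hA2 : M ^ 2 ≤ ((5 * M ^ 2 - 2) * z) ^ 2 := by
    have : 0 ≤ (M + 1) ^ 2 * (1 - 2 * M) * z ^ 2 :=
      mul_nonneg (mul_nonneg (sq_nonneg _) (by linarith)) (sq_nonneg _)
    linear_combination 4 * this - M ^ 2 * hz
  have hB2 : M ^ 2 ≤ ((3 * M ^ 2 + 4 * M - 2) * z) ^ 2 := by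
    have h1 := second_halfDistance_identity hz
    have : 0 ≤ (1 - M) * ((M + 1) * (2 * M - 1) ^ 2 * z ^ 2) :=
      mul_nonneg (by linarith) (by positivity)
    linarith
  have key : ∀ w, 0 < M + w → M ^ 2 ≤ w ^ 2 → M ≤ w := fun w h1 h2 => by nlinarith
  have hA3 := key _ hA hA2
  have hB3 := key _ hB hB2
  have hz0 : z < 0 := by
    by_contra hz0
    nlinarith [mul_nonneg (show 0 ≤ 2 - 5 * M ^ 2 by nlinarith) (not_lt.1 hz0)]
  have hB0 : 3 * M ^ 2 + 4 * M - 2 < 0 := by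
    by_contra h0
    nlinarith [mul_nonneg (not_lt.1 h0) (neg_nonneg.2 hz0.le)]
  have hS : 0 < 25 * M ^ 2 + 8 * M - 8 := by
    by_contra h0
    nlinarith [mul_nonneg (neg_nonneg.2 (not_lt.1 h0)) (sq_nonneg z)]
  -- The first inequality forces M < 0.39, the second M > 0.42.
  nlinarith

/-! ### Separating symmetric from asymmetric classes -/

theorem halfDistances_sq_eq_iff {m s r : ℝ} (hm : -1 < m)
    (h : pairConfig 1 s r ∈ collinearRelEq m) : s ^ 2 = r ^ 2 ↔ m = 1 := by
  obtain ⟨hs, hr, z, hz, ha, hb⟩ := isRelativeEquilibrium_pairConfig_one_imp hm h.1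
  have h1 : s ^ 2 - r ^ 2 = (m - 1) * z := by
    refine mul_left_cancel₀ (show 2 * (1 + m) ≠ 0 by linarith) ?_
    linear_combination ha - hb
  rw [← sub_eq_zero, h1, mul_eq_zero, sub_eq_zero]
  refine or_iff_left ?_
  rintro rfl
  norm_num at hz

theorem isSymmetricConfig_of_one {x : VortexConfig 4} (hx : x ∈ collinearRelEq 1) :
    IsSymmetricConfig x := by
  rcases exists_equiv_pairConfig hx.1.1 hx.2 with ⟨s, hs⟩ | ⟨s, r, hs⟩
  · exact (isSymmetricConfig_pairConfig_zero s 1).of_equiv hs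
  · have hm := collinearRelEq_of_equiv ((configSetoid 4).symm hs) hx
    refine IsSymmetricConfig.of_equiv hs ((isSymmetricConfig_pairConfig_one_iff hm.1.1).2 ?_)
    exact (halfDistances_sq_eq_iff (by norm_num) hm).2 rfl

theorem encard_configClasses_collinearRelEq (m : ℝ) :
    (configClasses (collinearRelEq m)).encard =
      {s : ℝ | pairConfig 0 s 1 ∈ collinearRelEq m}.encard +
      {p : ℝ × ℝ | pairConfig 1 p.1 p.2 ∈ collinearRelEq m}.encard :=
  encard_configClasses (fun _ h => h.1.1) (fun _ h => h.2) fun _ _ => collinearRelEq_of_equiv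

theorem encard_configClasses_symmetric {m : ℝ} (hm : -1 < m) (hm1 : m < 1) :
    (configClasses (symmetricCollinearRelEq m)).encard =
      {s : ℝ | pairConfig 0 s 1 ∈ collinearRelEq m}.encard := by
  rw [encard_configClasses (S := symmetricCollinearRelEq m) (fun _ h => h.1.1.1)
    (fun _ h => h.1.2) fun _ _ e h => ⟨collinearRelEq_of_equiv e h.1, h.2.of_equiv e⟩]
  have h1 : {s : ℝ | pairConfig 0 s 1 ∈ symmetricCollinearRelEq m} =
      {s : ℝ | pairConfig 0 s 1 ∈ collinearRelEq m} :=
    Set.ext fun s => ⟨fun h => h.1, fun h => ⟨h, isSymmetricConfig_pairConfig_zero s 1⟩⟩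
  have h2 : {p : ℝ × ℝ | pairConfig 1 p.1 p.2 ∈ symmetricCollinearRelEq m} = ∅ :=
    Set.eq_empty_of_forall_notMem fun p h => hm1.ne ((halfDistances_sq_eq_iff hm h.1).1
      ((isSymmetricConfig_pairConfig_one_iff h.1.1.1).1 h.2))
  rw [h1, h2, Set.encard_empty, add_zero]

theorem encard_configClasses_asymmetric {m : ℝ} (hm : -1 < m) (hm1 : m < 1) :
    (configClasses (asymmetricCollinearRelEq m)).encard =
      {p : ℝ × ℝ | pairConfig 1 p.1 p.2 ∈ collinearRelEq m}.encard := by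
  rw [encard_configClasses (S := asymmetricCollinearRelEq m) (fun _ h => h.1.1.1)
    (fun _ h => h.1.2) fun _ _ e h => ⟨collinearRelEq_of_equiv e h.1,
      fun h' => h.2 (h'.of_equiv ((configSetoid 4).symm e))⟩]
  have h1 : {s : ℝ | pairConfig 0 s 1 ∈ asymmetricCollinearRelEq m} = ∅ :=
    Set.eq_empty_of_forall_notMem fun s h => h.2 (isSymmetricConfig_pairConfig_zero s 1)
  have h2 : {p : ℝ × ℝ | pairConfig 1 p.1 p.2 ∈ asymmetricCollinearRelEq m} =
      {p : ℝ × ℝ | pairConfig 1 p.1 p.2 ∈ collinearRelEq m} :=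
    Set.ext fun p => ⟨fun h => h.1, fun h => ⟨h, fun h' => hm1.ne
      ((halfDistances_sq_eq_iff hm h).1 ((isSymmetricConfig_pairConfig_one_iff h.1.1).1 h'))⟩⟩
  rw [h1, h2, Set.encard_empty, zero_add]

/-! ### One class for each ordering -/

/-- Uniqueness comes from monotonicity. Existence is a pigeonhole argument: 12 classes with two
directions each inject into the 24 permutations, so every permutation is attained. -/
theorem existsUnique_class_of_ordering {m : ℝ} (hm : 0 < m) (σ : Equiv.Perm (Fin 4))
    (h12 : (configClasses (collinearRelEq m)).encard = 12) :
    ∃! q, q ∈ configClasses {x | x ∈ collinearRelEq m ∧ HasOrdering σ x} := by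
  have hΓ : ∀ i, 0 < pairStrengths m i := by
    intro i
    fin_cases i <;> simp [pairStrengths, hm]
  have huniq : ∀ (τ : Equiv.Perm (Fin 4)) x y, x ∈ collinearRelEq m → HasOrdering τ x →
      y ∈ collinearRelEq m → HasOrdering τ y → (configSetoid 4).r x y :=
    fun τ x y hx hox hy hoy => equiv_of_hasOrdering hΓ (by norm_num) hx.1 hox hy.1 hoy
  have hex : ∀ q : configClasses (collinearRelEq m), ∃ (x : VortexConfig 4)
      (τ : Equiv.Perm (Fin 4)), x ∈ collinearRelEq m ∧ HasOrdering τ x ∧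
        Quotient.mk (configSetoid 4) x = q := by
    rintro ⟨_, x, hx, rfl⟩
    obtain ⟨τ, hτ⟩ := exists_hasOrdering hx.1.1 hx.2
    exact ⟨x, τ, hx, hτ, rfl⟩
  choose x τ hx hτ hq using hex
  have : Finite (configClasses (collinearRelEq m)) :=
    Set.finite_of_encard_eq_coe (k := 12) h12
  -- The Boolean records the direction in which the line is traversed.
  let f : configClasses (collinearRelEq m) × Bool → Equiv.Perm (Fin 4) :=
    fun p => if p.2 then Fin.revPerm.trans (τ p.1) else τ p.1
  have hf : ∀ p, HasOrdering (f p) (x p.1) := fun p => by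
    by_cases h : p.2
    · simpa [f, h] using (hτ p.1).reverse
    · simpa [f, h] using hτ p.1
  have hrev : ∀ τ : Equiv.Perm (Fin 4), Fin.revPerm.trans τ ≠ τ := fun τ h => by
    have := congrArg (fun e : Equiv.Perm (Fin 4) => e 0) h
    simp at this
  have hfinj : Function.Injective f := by
    rintro ⟨q, b⟩ ⟨q', b'⟩ h
    have hqq : q = q' := by
      have h1 := hf (q, b)
      have h2 := hf (q', b')
      rw [← h] at h2
      refine Subtype.ext ?_
      rw [← hq, ← hq]
      exact Quotient.sound (huniq _ _ _ (hx q) h1 (hx q') h2)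
    subst hqq
    have hb := hrev (τ q)
    cases b <;> cases b'
    · rfl
    · exact absurd (by simpa [f] using h.symm) hb
    · exact absurd (by simpa [f] using h) hb
    · rfl
  have hcard : Nat.card (configClasses (collinearRelEq m) × Bool) =
      Nat.card (Equiv.Perm (Fin 4)) := by
    have h1 : Nat.card (configClasses (collinearRelEq m)) = 12 := by
      rw [Nat.card_coe_set_eq, Set.ncard, h12]
      rfl
    rw [Nat.card_prod, h1, Nat.card_perm]
    simp
    decide
  obtain ⟨p, hp⟩ := ((Nat.bijective_iff_injective_and_card f).2 ⟨hfinj, hcard⟩).2 σ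
  refine ⟨Quotient.mk (configSetoid 4) (x p.1), ⟨_, ⟨hx p.1, hp ▸ hf p⟩, rfl⟩, ?_⟩
  rintro _ ⟨y, ⟨hy, hoy⟩, rfl⟩
  exact Quotient.sound (huniq σ _ _ hy hoy (hx p.1) (hp ▸ hf p))

/-! ### Equal strengths -/

theorem configSetoid_comp {n : ℕ} {x y : VortexConfig n} (h : (configSetoid n).r x y)
    (σ : Equiv.Perm (Fin n)) : (configSetoid n).r (x ∘ σ) (y ∘ σ) := by
  obtain ⟨a, b, ha, hab⟩ := h
  exact ⟨a, b, ha, fun i => hab (σ i)⟩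

/-- A symmetric configuration has two pairs of mirror images. When all strengths agree, the labels
can be changed so that these become the two pairs, and their midpoints then coincide. -/
theorem exists_perm_equiv_pairConfig_zero {x : VortexConfig 4} (hx : x ∈ collinearRelEq 1) :
    ∃ (σ : Equiv.Perm (Fin 4)) (s : ℝ), (s ^ 2) ^ 2 - 10 * s ^ 2 + 1 = 0 ∧
      (configSetoid 4).r (x ∘ σ) (pairConfig 0 s 1) := by
  rcases exists_equiv_pairConfig hx.1.1 hx.2 with ⟨s, hs⟩ | ⟨s, r, hs⟩
  · have hm := collinearRelEq_of_equiv ((configSetoid 4).symm hs) hx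
    refine ⟨1, s, ?_, (configSetoid 4).symm hs⟩
    linear_combination (pairConfig_zero_mem_iff (by norm_num) s).1 hm
  · have hm := collinearRelEq_of_equiv ((configSetoid 4).symm hs) hx
    have hsr := (halfDistances_sq_eq_iff (by norm_num) hm).2 rfl
    obtain ⟨-, -, z, hz, ha, -⟩ := isRelativeEquilibrium_pairConfig_one_imp (by norm_num) hm.1
    have hs4 : (s ^ 2) ^ 2 - s ^ 2 + 1 / 16 = 0 := by
      have h1 : s ^ 2 - 1 / 2 = 9 / 2 * z := by linear_combination ha / 4
      linear_combination (s ^ 2 - 1 / 2 + 9 / 2 * z) * h1 + 3 / 16 * hz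
    have hd : s + 1 / 2 ≠ 0 := fun e => by
      have : s = -1 / 2 := by linarith
      rw [this] at hs4
      norm_num at hs4
    -- The mirror pairs about 1/2 are {s, 1 - s} and {-s, 1 + s}, with signed half-distances s - 1/2
    -- and s + 1/2; q is their ratio.
    obtain ⟨q, hq⟩ : ∃ q, q * (s + 1 / 2) = s - 1 / 2 := ⟨_, div_mul_cancel₀ _ hd⟩
    have hq4 : (q ^ 2) ^ 2 - 10 * q ^ 2 + 1 = 0 := by
      have h2 : (q * (s + 1 / 2)) ^ 2 = (s - 1 / 2) ^ 2 := by rw [hq]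
      refine mul_left_cancel₀ (pow_ne_zero 4 hd) ?_
      linear_combination ((q * (s + 1 / 2)) ^ 2 + (s - 1 / 2) ^ 2 - 10 * (s + 1 / 2) ^ 2) * h2 -
        8 * hs4
    have key : ∀ σ : Equiv.Perm (Fin 4), (configSetoid 4).r (pairConfig 0 q 1)
        (pairConfig 1 s r ∘ σ) → (configSetoid 4).r (x ∘ σ) (pairConfig 0 q 1) := fun σ h =>
      (configSetoid 4).symm ((configSetoid 4).trans h (configSetoid_comp hs σ))
    rcases sq_eq_sq_iff_eq_or_eq_neg.1 hsr with rfl | h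
    · have e : ∀ i, Equiv.swap (1 : Fin 4) 3 i = ![0, 3, 2, 1] i := by decide
      refine ⟨_, q, hq4, key (Equiv.swap 1 3) ⟨(s + 1 / 2 : ℝ), (1 / 2 : ℝ),
        by exact_mod_cast hd, fun i => ?_⟩⟩
      simp only [Function.comp_apply, e, pairConfig]
      norm_cast
      fin_cases i <;> simp <;> linarith
    · obtain rfl : r = -s := by linarith
      have e : ∀ i, (Equiv.swap 1 2 * Equiv.swap 2 3 : Equiv.Perm (Fin 4)) i = ![0, 2, 3, 1] i := by decide
      refine ⟨_, q, hq4, key (Equiv.swap 1 2 * Equiv.swap 2 3) ⟨(s + 1 / 2 : ℝ), (1 / 2 : ℝ),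
        by exact_mod_cast hd, fun i => ?_⟩⟩
      simp only [Function.comp_apply, e, pairConfig]
      norm_cast
      fin_cases i <;> simp <;> linarith

/-- The quartic is even and reciprocal, so its roots are ±s and ±1/s. A change of sign swaps the
members of the first pair; inversion exchanges the two pairs after rescaling. -/
theorem exists_perm_pairConfig_zero_equiv {s s' : ℝ} (hs : (s ^ 2) ^ 2 - 10 * s ^ 2 + 1 = 0)
    (hs' : (s' ^ 2) ^ 2 - 10 * s' ^ 2 + 1 = 0) :
    ∃ σ : Equiv.Perm (Fin 4), (configSetoid 4).r (pairConfig 0 s 1 ∘ σ) (pairConfig 0 s' 1) := by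
  have h : (s' - s) * (s' + s) * ((s * s' - 1) * (s * s' + 1)) = 0 := by
    linear_combination s ^ 2 * hs' - s' ^ 2 * hs
  have hs0 : s' ≠ 0 := by rintro rfl; norm_num at hs'
  have key : ∀ (σ : Equiv.Perm (Fin 4)) (v : Fin 4 → Fin 4) (a : ℝ), a ≠ 0 → (∀ i, σ i = v i) →
      (∀ i, ![s', -s', 1, -1] i = a * ![s, -s, 1, -1] (v i)) →
      ∃ σ : Equiv.Perm (Fin 4),
        (configSetoid 4).r (pairConfig 0 s 1 ∘ σ) (pairConfig 0 s' 1) := by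
    intro σ v a ha hv h
    refine ⟨σ, a, 0, by exact_mod_cast ha, fun i => ?_⟩
    simp only [Function.comp_apply, hv, pairConfig, zero_add, zero_sub, add_zero]
    exact_mod_cast h i
  rcases mul_eq_zero.1 h with h | h <;> rcases mul_eq_zero.1 h with h | h
  · refine key 1 ![0, 1, 2, 3] 1 one_ne_zero (by decide) fun i => ?_
    fin_cases i <;> simp <;> linarith
  · refine key (Equiv.swap 0 1) ![1, 0, 2, 3] 1 one_ne_zero (by decide) fun i => ?_
    fin_cases i <;> simp <;> linarith
  · refine key (Equiv.swap 0 2 * Equiv.swap 1 3) ![2, 3, 0, 1] s' hs0 (by decide) fun i => ?_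
    fin_cases i <;> simp <;> linarith
  · refine key (Equiv.swap 0 1 * (Equiv.swap 0 2 * Equiv.swap 1 3)) ![2, 3, 1, 0] s' hs0
      (by decide) fun i => ?_
    fin_cases i <;> simp <;> linarith

theorem exists_perm_equiv_of_one {x y : VortexConfig 4} (hx : x ∈ collinearRelEq 1)
    (hy : y ∈ collinearRelEq 1) : ∃ σ : Equiv.Perm (Fin 4), (configSetoid 4).r (x ∘ σ) y := by
  obtain ⟨σ, s, hs, h⟩ := exists_perm_equiv_pairConfig_zero hx
  obtain ⟨σ', s', hs', h'⟩ := exists_perm_equiv_pairConfig_zero hy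
  obtain ⟨τ, hτ⟩ := exists_perm_pairConfig_zero_equiv hs hs'
  have h1 := (configSetoid 4).trans ((configSetoid 4).trans (configSetoid_comp h τ) hτ)
    ((configSetoid 4).symm h')
  have h2 := configSetoid_comp h1 σ'⁻¹
  refine ⟨σ * τ * σ'⁻¹, ?_⟩
  have e : (y ∘ σ') ∘ ⇑σ'⁻¹ = y := by
    funext i
    simp
  rw [e] at h2
  exact h2

/-! ### The main theorem -/

theorem mainTheorem3 (m : ℝ) :
    (m ∈ Set.Ioc (0 : ℝ) 1 →
      (configClasses (collinearRelEq m)).encard = 12 ∧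
      ∀ σ : Equiv.Perm (Fin 4),
        ∃! q, q ∈ configClasses {x | x ∈ collinearRelEq m ∧ HasOrdering σ x}) ∧
    (m = 1 →
      (∀ x ∈ collinearRelEq m, IsSymmetricConfig x) ∧
      ∀ x ∈ collinearRelEq m, ∀ y ∈ collinearRelEq m,
        ∃ σ : Equiv.Perm (Fin 4), (configSetoid 4).r (x ∘ σ) y) ∧
    (m ∈ Set.Ioo (0 : ℝ) 1 →
      (configClasses (symmetricCollinearRelEq m)).encard = 4 ∧
      (configClasses (asymmetricCollinearRelEq m)).encard = 8) ∧
    (m ∈ Set.Ioo (-1 / 2 : ℝ) 0 →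
      (configClasses (collinearRelEq m)).encard = 6 ∧
      (configClasses (symmetricCollinearRelEq m)).encard = 2 ∧
      (configClasses (asymmetricCollinearRelEq m)).encard = 4) ∧
    (m ∈ Set.Ioc (-1 : ℝ) (-1 / 2) →
      (configClasses (collinearRelEq m)).encard = 2 ∧
      (configClasses (symmetricCollinearRelEq m)).encard = 2 ∧
      asymmetricCollinearRelEq m = ∅) := by
  refine ⟨fun ⟨h0, h1⟩ => ?_, ?_, fun ⟨h0, h1⟩ => ?_, fun ⟨h0, h1⟩ => ?_, fun ⟨h0, h1⟩ => ?_⟩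
  · have h12 : (configClasses (collinearRelEq m)).encard = 12 := by
      rw [encard_configClasses_collinearRelEq, encard_pairConfig_zero_of_pos h0,
        encard_pairConfig_one_of_pos h0]
      norm_num
    exact ⟨h12, fun σ => existsUnique_class_of_ordering h0 σ h12⟩
  · rintro rfl
    exact ⟨fun x => isSymmetricConfig_of_one, fun x hx y hy => exists_perm_equiv_of_one hx hy⟩
  · rw [encard_configClasses_symmetric (by linarith) h1,
      encard_configClasses_asymmetric (by linarith) h1]
    exact ⟨encard_pairConfig_zero_of_pos h0, encard_pairConfig_one_of_pos h0⟩
  · rw [encard_configClasses_collinearRelEq, encard_configClasses_symmetric (by linarith)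
      (by linarith), encard_configClasses_asymmetric (by linarith) (by linarith),
      encard_pairConfig_zero_of_neg h1 (by linarith), encard_pairConfig_one_of_neg h1 h0]
    norm_num
  · have he : {p : ℝ × ℝ | pairConfig 1 p.1 p.2 ∈ collinearRelEq m} = ∅ :=
      Set.eq_empty_of_forall_notMem fun p => pairConfig_one_notMem h0 h1 p.1 p.2
    have ha := encard_configClasses_asymmetric h0 (show m < 1 by linarith)
    rw [he, Set.encard_empty, Set.encard_eq_zero, configClasses, Set.image_eq_empty] at ha
    rw [encard_configClasses_collinearRelEq, encard_configClasses_symmetric h0 (by linarith),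
      encard_pairConfig_zero_of_neg (by linarith) h0, he, Set.encard_empty, add_zero]
    exact ⟨rfl, rfl, ha⟩
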